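/- Let $B_{2,n}$ ($n \ge 0$) be defined by $$\frac{x^2/2}{e^x-1-x} = \sum_{n=0}^{\infty} \frac{B_{2,n}}{n!}\,x^n .$$ Among the zeros of $e^z-1-z$ in the open upper half-plane there is one, $z_1$, whose modulus is strictly smaller than that of every other such zero. Put $r_1=|z_1|$. Then $r_1 \approx 7.748$ (precisely, $|r_1-7.748|<0.0005$), and for every integer $n>2$ $$|B_{2,n}| < \frac{2\,n!}{r_1^{\,n}} \qquad\text{and}\qquad |B_{2,n}| < \frac{n!}{7^{n}},$$ the second bound being Howard's conjecture. Moreover, the power series above has radius of convergence $r_1$; the first bound is sharp in the sense that for all real $R>r_1$ and $C$ one has $|B_{2,n}| > C\,n!/R^{n}$ for infinitely many $n$; and the sequence $(B_{2,n})_{n\ge 0}$ is unbounded. -/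

import Mathlib

open PowerSeries in
/-- The power series `∑ 2 / (n + 2)! * x ^ n`, that is, `(e ^ x - 1 - x) / (x ^ 2 / 2)`. -/
noncomputable def expTailSeries : ℚ⟦X⟧ :=
  PowerSeries.mk fun n => 2 / ((n + 2).factorial : ℚ)

open PowerSeries in
/-- The power series expansion of `(x ^ 2 / 2) / (e ^ x - 1 - x)`;
see `exp_sub_mul_hyperBernoulliSeries`. -/
noncomputable def hyperBernoulliSeries : ℚ⟦X⟧ := expTailSeries⁻¹

/-- The generalized Bernoulli numbers `B_{2,n}`, defined by
`(x ^ 2 / 2) / (e ^ x - 1 - x) = ∑ B_{2,n} / n! * x ^ n`. -/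
noncomputable def hyperBernoulli (n : ℕ) : ℚ :=
  (n.factorial : ℚ) * PowerSeries.coeff n hyperBernoulliSeries

open PowerSeries in
theorem exp_sub_eq_mul_expTailSeries :
    PowerSeries.exp ℚ - 1 - X = C (1 / 2 : ℚ) * X ^ 2 * expTailSeries := by
  ext n
  rw [mul_assoc, coeff_C_mul, coeff_X_pow_mul']
  rcases n with _ | _ | n
  · simp
  · simp [coeff_one, coeff_X]
  · simp [expTailSeries, coeff_exp, coeff_one, coeff_X]
    ring

open PowerSeries in
/-- The defining identity of the generating function, in `ℚ⟦X⟧`. -/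
theorem exp_sub_mul_hyperBernoulliSeries :
    (PowerSeries.exp ℚ - 1 - X) * hyperBernoulliSeries = C (1 / 2 : ℚ) * X ^ 2 := by
  have h : constantCoeff expTailSeries ≠ 0 := by
    rw [← coeff_zero_eq_constantCoeff_apply]
    simp [expTailSeries]
  rw [exp_sub_eq_mul_expTailSeries, hyperBernoulliSeries, mul_assoc,
    PowerSeries.mul_inv_cancel _ h, mul_one]

/-- `z` is the zero `z₁` of `e ^ z - 1 - z` of smallest modulus in the open upper half-plane:
every other zero there has strictly larger modulus. -/
def IsFirstUpperZero (z : ℂ) : Prop :=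
  (0 < z.im ∧ Complex.exp z - 1 - z = 0) ∧
    ∀ w : ℂ, 0 < w.im → Complex.exp w - 1 - w = 0 → w ≠ z → ‖z‖ < ‖w‖

/-! The function `z ^ 2 / (2 * (exp z - 1 - z))` has, in the strip `|Im z| < 12`, only the simple
poles `a = z₁` and its conjugate `b`, with residues `a / 2` and `b / 2`. Subtracting the polar parts
leaves `h`, holomorphic in the strip (`exists_regular_part`). The maximum principle on a rectangle
gives `‖h‖ ≤ 16`, and Cauchy's estimate on radius 10.9 gives `|B_{2,n} / n! + Re (a⁻ⁿ)| ≤ 16 / 10.9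
^ n` (`abs_hyperBernoulli_add_le`). All the bounds follow from this, except for small `n`, where
exact values are used.

The zero `a` is found as a fixed point of `log (1 + z) + 2πi`, a contraction: this gives uniqueness
below height `4π`, and existence with a numerical enclosure. -/

/-! ### Zeros below height `4π` as fixed points of a contraction. -/

theorem exp_eq_iff_re_im {w : ℂ} : Complex.exp w - 1 - w = 0 ↔
    Real.exp w.re * Real.cos w.im = 1 + w.re ∧ Real.exp w.re * Real.sin w.im = w.im := by
  rw [Complex.ext_iff]
  simp only [Complex.sub_re, Complex.sub_im, Complex.exp_re, Complex.exp_im, Complex.one_re,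
    Complex.one_im, Complex.zero_re, Complex.zero_im]
  constructor <;> rintro ⟨h1, h2⟩ <;> constructor <;> linarith

/-- Zeros of `exp w - 1 - w` in the open upper half-plane below height `4 π`. -/
theorem zero_location {w : ℂ} (hw : 0 < w.im) (h : Complex.exp w - 1 - w = 0)
    (h4 : w.im < 4 * Real.pi) :
    0 < w.re ∧ 2 * Real.pi < w.im ∧ w.im < 5 * Real.pi / 2 := by
  obtain ⟨h1, h2⟩ := exp_eq_iff_re_im.1 h
  set x := w.re
  set y := w.im
  have hpi := Real.pi_pos
  have hs : 0 < Real.sin y := by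
    by_contra hs
    have := mul_nonpos_of_nonneg_of_nonpos (Real.exp_pos x).le (not_lt.1 hs)
    linarith
  have hx : 0 < x := by
    by_contra hx
    have h3 : Real.exp x ≤ 1 := Real.exp_le_one_iff.2 (not_lt.1 hx)
    have h4 := Real.sin_lt hw
    nlinarith
  have hc : 0 < Real.cos y := by
    by_contra hc
    have := mul_nonpos_of_nonneg_of_nonpos (Real.exp_pos x).le (not_lt.1 hc)
    linarith
  have hs1 : ¬ (Real.pi ≤ y ∧ y ≤ 2 * Real.pi) := by
    rintro ⟨ha, hb⟩
    have := Real.sin_nonneg_of_nonneg_of_le_pi (x := y - Real.pi) (by linarith) (by linarith)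
    rw [Real.sin_sub_pi] at this
    linarith
  have hs2 : y < 3 * Real.pi := by
    by_contra hb
    have := Real.sin_nonneg_of_nonneg_of_le_pi (x := y - 2 * Real.pi - Real.pi)
      (by linarith) (by linarith)
    rw [Real.sin_sub_pi, Real.sin_sub_two_pi] at this
    linarith
  have hc1 : ¬ (Real.pi / 2 ≤ y ∧ y ≤ Real.pi) := by
    rintro ⟨ha, hb⟩
    have := Real.cos_nonpos_of_pi_div_two_le_of_le (x := y) (by linarith) (by linarith)
    linarith
  have hc2 : y < 5 * Real.pi / 2 := by
    by_contra hb
    have := Real.cos_nonpos_of_pi_div_two_le_of_le (x := y - 2 * Real.pi)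
      (by linarith) (by linarith)
    rw [Real.cos_sub_two_pi] at this
    linarith
  -- The two equations give `tan y = y / (1 + x) < y`, impossible on `(0, π / 2)`.
  have h0 : Real.pi / 2 ≤ y := by
    by_contra hb
    have h3 := Real.lt_tan hw (not_le.1 hb)
    rw [Real.tan_eq_sin_div_cos, lt_div_iff₀ hc] at h3
    have h5 : Real.sin y * (1 + x) = y * Real.cos y := by
      linear_combination (-Real.sin y) * h1 + Real.cos y * h2
    nlinarith
  refine ⟨hx, ?_, hc2⟩
  by_contra hb
  rcases le_total y Real.pi with h6 | h6
  · exact hc1 ⟨h0, h6⟩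
  · exact hs1 ⟨h6, not_lt.1 hb⟩

/-- A closed convex region on which `z ↦ log (1 + z) + 2 π i` is a contraction. -/
def contractionRegion : Set ℂ := {z | 0 ≤ z.re ∧ 6 ≤ z.im}

/-- The branch of `log (1 + z)` whose fixed points are zeros of `exp z - 1 - z`. -/
noncomputable def shiftedLog (z : ℂ) : ℂ := Complex.log (1 + z) + 2 * Real.pi * Complex.I

theorem one_add_ne_zero_of_im {z : ℂ} (hz : 6 ≤ z.im) : 1 + z ≠ 0 := by
  intro h
  have := congrArg Complex.im h
  simp at this
  linarith

theorem shiftedLog_fixed {z : ℂ} (hz : z ∈ contractionRegion) (h : shiftedLog z = z) :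
    Complex.exp z - 1 - z = 0 := by
  have h1 : Complex.exp z = 1 + z := by
    conv_lhs => rw [← h]
    rw [shiftedLog, Complex.exp_add, Complex.exp_log (one_add_ne_zero_of_im hz.2),
      Complex.exp_two_pi_mul_I, mul_one]
  rw [h1]
  ring

/-- By `zero_location`, `w - 2πi` has imaginary part in `(0, π / 2)`, so the principal logarithm
recovers it from `1 + w`. -/
theorem shiftedLog_of_zero {w : ℂ} (hw : 0 < w.im) (h : Complex.exp w - 1 - w = 0)
    (h4 : w.im < 4 * Real.pi) : w ∈ contractionRegion ∧ shiftedLog w = w := by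
  obtain ⟨h1, h2, h3⟩ := zero_location hw h h4
  have hpi := Real.pi_gt_three
  refine ⟨⟨h1.le, by linarith⟩, ?_⟩
  have h5 : 1 + w = Complex.exp (w - 2 * Real.pi * Complex.I) := by
    rw [Complex.exp_sub, Complex.exp_two_pi_mul_I, div_one]
    linear_combination -h
  rw [shiftedLog, h5, Complex.log_exp]
  · ring
  · simp
    linarith
  · simp
    linarith

theorem shiftedLog_mapsTo : Set.MapsTo shiftedLog contractionRegion contractionRegion := by
  rintro z ⟨h1, h2⟩
  have hpi := Real.pi_gt_three
  constructor
  · simp only [shiftedLog, Complex.add_re, Complex.log_re]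
    have h3 : 1 ≤ ‖1 + z‖ := by
      have := Complex.abs_im_le_norm (1 + z)
      have h4 := le_abs_self (1 + z).im
      simp at this h4
      linarith
    have := Real.log_nonneg h3
    simpa using this
  · have h3 : 0 ≤ (1 + z).arg := by
      rw [Complex.arg_nonneg_iff]
      simp
      linarith
    simp only [shiftedLog, Complex.add_im, Complex.log_im]
    simp
    linarith

/-- The derivative is `1 / (1 + z)`, and `‖1 + z‖ ≥ Im z ≥ 6`. -/
theorem shiftedLog_lipschitz : LipschitzOnWith (1 / 6) shiftedLog contractionRegion := by
  have hconv : Convex ℝ contractionRegion := by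
    have h1 := (convex_halfSpace_re_ge 0).inter (convex_halfSpace_im_ge 6)
    exact h1
  refine hconv.lipschitzOnWith_of_nnnorm_hasDerivWithin_le (f' := fun z => (1 + z)⁻¹) ?_ ?_
  · rintro z ⟨h1, h2⟩
    have h3 : 1 + z ∈ Complex.slitPlane := by
      left
      simp
      linarith
    have h4 : HasDerivAt (fun w : ℂ => 1 + w) 1 z := (hasDerivAt_id z).const_add 1
    have := (h4.clog h3).add_const (2 * Real.pi * Complex.I)
    rw [one_div] at this
    exact this.hasDerivWithinAt
  · rintro z ⟨h1, h2⟩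
    have h3 : 6 ≤ ‖1 + z‖ := by
      have := Complex.abs_im_le_norm (1 + z)
      have h4 := le_abs_self (1 + z).im
      simp at this h4
      linarith
    rw [← NNReal.coe_le_coe]
    simp only [coe_nnnorm, norm_inv]
    rw [← one_div]
    push_cast
    exact one_div_le_one_div_of_le (by norm_num) h3

theorem shiftedLog_unique {z w : ℂ} (hz : z ∈ contractionRegion) (hw : w ∈ contractionRegion)
    (h1 : shiftedLog z = z) (h2 : shiftedLog w = w) : z = w := by
  have := shiftedLog_lipschitz.dist_le_mul z hz w hw
  rw [h1, h2] at this
  push_cast at this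
  have h3 := dist_nonneg (x := z) (y := w)
  exact dist_le_zero.1 (by linarith)

/-! ### Numerical enclosure of the first zero. -/

/-- The argument approximates `z₁ - 2πi`; the Taylor polynomial of degree 14 is evaluated exactly.
-/
theorem norm_exp_approx :
    ‖Complex.exp ⟨2.088843, 1.178304⟩ - ⟨3.088843, 7.461489⟩‖ ≤ 0.00004 := by
  have hq : ‖(⟨2.088843, 1.178304⟩ : ℂ)‖ ≤ 2.4 := by
    rw [← sq_le_sq₀ (norm_nonneg _) (by norm_num), Complex.sq_norm, Complex.normSq_mk]
    norm_num
  have h1 := Complex.exp_bound' (x := ⟨2.088843, 1.178304⟩) (n := 15)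
    (by push_cast; linarith)
  have h2 : ‖(⟨2.088843, 1.178304⟩ : ℂ)‖ ^ 15 / (Nat.factorial 15 : ℝ) * 2 ≤ 0.00001 := by
    have := pow_le_pow_left₀ (norm_nonneg _) hq 15
    rw [div_mul_eq_mul_div, div_le_iff₀ (by positivity)]
    norm_num [Nat.factorial] at this ⊢
    linarith
  have h3 : ‖(∑ m ∈ Finset.range 15, (⟨2.088843, 1.178304⟩ : ℂ) ^ m / (m.factorial : ℂ))
      - ⟨3.088843, 7.461489⟩‖ ≤ 0.00003 := by
    have hdiv (a b : ℝ) (m : ℕ) : (⟨a, b⟩ : ℂ) / (m : ℂ) = ⟨a / m, b / m⟩ := by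
      apply Complex.ext <;> simp
    have hmul (a b c d : ℝ) : (⟨a, b⟩ : ℂ) * ⟨c, d⟩ = ⟨a * c - b * d, a * d + b * c⟩ := rfl
    have hadd (a b c d : ℝ) : (⟨a, b⟩ : ℂ) + ⟨c, d⟩ = ⟨a + c, b + d⟩ := rfl
    have hsub (a b c d : ℝ) : (⟨a, b⟩ : ℂ) - ⟨c, d⟩ = ⟨a - c, b - d⟩ := by
      apply Complex.ext <;> simp
    have hone : (1 : ℂ) = ⟨1, 0⟩ := rfl
    have hzero : (0 : ℂ) = ⟨0, 0⟩ := rfl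
    rw [← sq_le_sq₀ (norm_nonneg _) (by norm_num), Complex.sq_norm]
    norm_num [Finset.sum_range_succ, pow_succ, hone, hzero, hmul, hdiv, hadd, hsub,
      Complex.normSq_mk, Nat.factorial]
  calc _ ≤ _ := norm_sub_le_norm_sub_add_norm_sub _ _ _
    _ ≤ _ := add_le_add (h1.trans h2) h3
    _ ≤ _ := by norm_num

/-- The iteration starts at `p = exp q - 1`, where `shiftedLog p = q + 2πi` exactly, so no logarithm
needs numerical estimation. -/
theorem exists_first_zero : ∃ z : ℂ, z ∈ contractionRegion ∧ shiftedLog z = z ∧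
    ‖z - ⟨2.088843, 7.461489⟩‖ ≤ 0.0001 := by
  set q : ℂ := ⟨2.088843, 1.178304⟩ with hq
  set p : ℂ := Complex.exp q - 1 with hp
  have hpi := Real.pi_gt_d6
  have hpi' := Real.pi_lt_d6
  have happ : ‖p - ⟨2.088843, 7.461489⟩‖ ≤ 0.00004 := by
    convert norm_exp_approx using 2
    rw [hp, sub_sub]
    congr 1
    apply Complex.ext <;> norm_num
  have hps : p ∈ contractionRegion := by
    have h1 := (Complex.abs_re_le_norm _).trans happ
    have h2 := (Complex.abs_im_le_norm _).trans happ
    rw [abs_le] at h1 h2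
    simp only [Complex.sub_re, Complex.sub_im] at h1 h2
    constructor <;> linarith
  have hGp : shiftedLog p = q + 2 * Real.pi * Complex.I := by
    rw [shiftedLog, hp, add_sub_cancel, Complex.log_exp] <;> simp only [hq] <;> linarith
  have hd : dist p (shiftedLog p) ≤ 0.00005 := by
    rw [dist_eq_norm, hGp]
    refine (norm_sub_le_norm_sub_add_norm_sub _ ⟨2.088843, 7.461489⟩ _).trans ?_
    have : ‖(⟨2.088843, 7.461489⟩ : ℂ) - (q + 2 * Real.pi * Complex.I)‖ ≤ 0.00001 := by
      refine (Complex.norm_le_abs_re_add_abs_im _).trans ?_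
      simp only [hq, Complex.sub_re, Complex.sub_im, Complex.add_re, Complex.add_im]
      simp
      rw [abs_le]
      constructor <;> linarith
    linarith
  have hcl : IsComplete contractionRegion := by
    apply IsClosed.isComplete
    exact (isClosed_le continuous_const Complex.continuous_re).inter
      (isClosed_le continuous_const Complex.continuous_im)
  have hK : ContractingWith (1 / 6) (shiftedLog_mapsTo.restrict shiftedLog _ _) := by
    refine ⟨by rw [← NNReal.coe_lt_coe]; norm_num, ?_⟩
    exact shiftedLog_lipschitz.mapsToRestrict shiftedLog_mapsTo
  obtain ⟨z, hz, hfix, -, -⟩ := hK.exists_fixedPoint' hcl shiftedLog_mapsTo hps (edist_ne_top _ _)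
  refine ⟨z, hz, hfix, ?_⟩
  -- `d ≤ 0.00005 + d / 6` for `d = dist p z` yields `d ≤ 0.00006`; adding `happ` gives 0.0001.
  have h1 := shiftedLog_lipschitz.dist_le_mul p hps z hz
  rw [hfix.eq] at h1
  push_cast at h1
  have h2 := dist_triangle p (shiftedLog p) z
  have h3 := norm_sub_le_norm_sub_add_norm_sub z p ⟨2.088843, 7.461489⟩
  rw [← dist_eq_norm z p, dist_comm] at h3
  linarith

theorem norm_bounds_of_approx {z : ℂ} (h : ‖z - ⟨2.088843, 7.461489⟩‖ ≤ 0.0001) :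
    7.7482 < ‖z‖ ∧ ‖z‖ < 7.7485 := by
  have h1 : 7.7483 < ‖(⟨2.088843, 7.461489⟩ : ℂ)‖ := by
    rw [← sq_lt_sq₀ (by norm_num) (norm_nonneg _), Complex.sq_norm, Complex.normSq_mk]
    norm_num
  have h2 : ‖(⟨2.088843, 7.461489⟩ : ℂ)‖ < 7.7484 := by
    rw [← sq_lt_sq₀ (norm_nonneg _) (by norm_num), Complex.sq_norm, Complex.normSq_mk]
    norm_num
  have h3 := abs_le.1 ((abs_norm_sub_norm_le z ⟨2.088843, 7.461489⟩).trans h)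
  constructor <;> linarith

theorem isFirstUpperZero_of_fixed {z : ℂ} (hz : z ∈ contractionRegion) (hf : shiftedLog z = z)
    (h : ‖z - ⟨2.088843, 7.461489⟩‖ ≤ 0.0001) : IsFirstUpperZero z := by
  refine ⟨⟨by linarith [hz.2], shiftedLog_fixed hz hf⟩, fun w hw h0 hne => ?_⟩
  have h4 : 4 * Real.pi ≤ w.im := by
    by_contra h4
    obtain ⟨h5, h6⟩ := shiftedLog_of_zero hw h0 (not_le.1 h4)
    exact hne (shiftedLog_unique h5 hz h6 hf)
  have := (le_abs_self _).trans (Complex.abs_im_le_norm w)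
  linarith [(norm_bounds_of_approx h).2, Real.pi_gt_three]

/-! ### Removal of the poles. -/

theorem exists_eq_sub_mul {A : ℂ → ℂ} (hA : Differentiable ℂ A) {a : ℂ}
    (h : A a = 0) : ∃ K : ℂ → ℂ, Differentiable ℂ K ∧ ∀ z, A z = (z - a) * K z := by
  refine ⟨dslope A a, ?_, fun z => ?_⟩
  · rw [← differentiableOn_univ] at hA ⊢
    exact (Complex.differentiableOn_dslope Filter.univ_mem).2 hA
  · have := sub_smul_dslope A a z
    rw [smul_eq_mul, h, sub_zero] at this
    exact this.symm

theorem deriv_of_eq_sub_mul {A K : ℂ → ℂ} (hK : Differentiable ℂ K) {a : ℂ}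
    (h : ∀ z, A z = (z - a) * K z) (w : ℂ) : deriv A w = K w + (w - a) * deriv K w := by
  rw [funext h]
  have := ((hasDerivAt_id w).sub_const a).mul (hK w).hasDerivAt
  simpa [Pi.mul_def] using this.deriv

/-- `exp z - 1 - z`. -/
noncomputable def expTail (z : ℂ) : ℂ := Complex.exp z - 1 - z

theorem expTail_zero : expTail 0 = 0 := by simp [expTail]

theorem hasDerivAt_expTail (z : ℂ) : HasDerivAt expTail (Complex.exp z - 1) z :=
  ((Complex.hasDerivAt_exp z).sub_const 1).sub (hasDerivAt_id z)

theorem deriv_expTail : deriv expTail = fun z => Complex.exp z - 1 :=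
  funext fun z => (hasDerivAt_expTail z).deriv

theorem differentiable_expTail : Differentiable ℂ expTail :=
  fun z => (hasDerivAt_expTail z).differentiableAt

/-- Hence nonzero zeros are simple, and the residue of `z ^ 2 / (2 * expTail z)` at `a` is `a / 2`.
-/
theorem deriv_expTail_of_zero {a : ℂ} (h : expTail a = 0) : deriv expTail a = a := by
  rw [deriv_expTail]
  rw [expTail] at h
  linear_combination h

/-- An entire function with a double zero at `0` and zeros at `a`, `b` is divisible by
`z ^ 2 (z - a) (z - b)`. -/
theorem exists_eq_sq_mul {A : ℂ → ℂ} (hA : Differentiable ℂ A) {a b : ℂ}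
    (ha : a ≠ 0) (hb : b ≠ 0) (hab : a ≠ b) (h0 : A 0 = 0) (h0' : deriv A 0 = 0)
    (hAa : A a = 0) (hAb : A b = 0) :
    ∃ S : ℂ → ℂ, Differentiable ℂ S ∧ ∀ z, A z = z ^ 2 * ((z - a) * ((z - b) * S z)) := by
  obtain ⟨K1, d1, e1⟩ := exists_eq_sub_mul hA h0
  have h1 := deriv_of_eq_sub_mul d1 e1 0
  rw [h0'] at h1
  obtain ⟨K2, d2, e2⟩ := exists_eq_sub_mul d1 (a := 0) (by simpa using h1.symm)
  have h2 : K2 a = 0 := by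
    have := e1 a
    rw [hAa, e2] at this
    simpa [ha] using this
  have h3 : K2 b = 0 := by
    have := e1 b
    rw [hAb, e2] at this
    simpa [hb] using this
  obtain ⟨K3, d3, e3⟩ := exists_eq_sub_mul d2 h2
  have h4 : K3 b = 0 := by
    rw [e3] at h3
    simpa [sub_eq_zero, hab.symm] using h3
  obtain ⟨K4, d4, e4⟩ := exists_eq_sub_mul d3 h4
  refine ⟨K4, d4, fun z => ?_⟩
  rw [e1, e2, e3, e4]
  ring

/-- Removing the poles of `z ^ 2 / (2 (exp z - 1 - z))` at `0`, `a`, `b`. -/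
theorem exists_regular_part {a b : ℂ} {V : Set ℂ} (ha : a ≠ 0) (hb : b ≠ 0) (hab : a ≠ b)
    (hga : expTail a = 0) (hgb : expTail b = 0)
    (hV : ∀ z ∈ V, expTail z = 0 → z = 0 ∨ z = a ∨ z = b) :
    ∃ h : ℂ → ℂ, DifferentiableOn ℂ h V ∧ ∀ z ∈ V, z ≠ a → z ≠ b →
      (h z + a / 2 * (z - a)⁻¹ + b / 2 * (z - b)⁻¹) * expTail z = z ^ 2 / 2 := by
  have hg0' : deriv expTail 0 = 0 := deriv_expTail_of_zero expTail_zero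
  obtain ⟨S, dS, eS⟩ := exists_eq_sq_mul differentiable_expTail ha hb hab expTail_zero hg0' hga hgb
  obtain ⟨G1, d1, e1⟩ := exists_eq_sub_mul differentiable_expTail hga
  obtain ⟨G2, d2, e2⟩ := exists_eq_sub_mul differentiable_expTail hgb
  -- Otherwise the second derivative of `expTail` at `0` would vanish, but it is `1`.
  have S0 : S 0 ≠ 0 := by
    intro hS
    set K : ℂ → ℂ := fun z => (z - a) * ((z - b) * S z) with hK
    have dK : Differentiable ℂ K := by fun_prop
    have dzK : Differentiable ℂ fun z => z * K z := by fun_prop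
    have q1 : ∀ z, expTail z = (z - 0) * (z * K z) := fun z => by rw [eS]; ring
    have q2 : ∀ z, deriv expTail z = (z - 0) * (K z + (K z + z * deriv K z)) := by
      intro z
      rw [deriv_of_eq_sub_mul dzK q1 z,
        deriv_of_eq_sub_mul dK (A := fun z => z * K z) (a := 0) (fun z => by ring) z]
      ring
    have dd : Differentiable ℂ (deriv K) := by
      rw [← differentiableOn_univ] at dK ⊢
      exact dK.deriv isOpen_univ
    have q3 := deriv_of_eq_sub_mul (by fun_prop) q2 0
    rw [deriv_expTail] at q3
    simp [hK, hS] at q3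
  have Sa : S a ≠ 0 := by
    intro hS
    have := deriv_of_eq_sub_mul (A := expTail) (a := a) (K := fun z => z ^ 2 * ((z - b) * S z))
      (by fun_prop) (fun z => by rw [eS]; ring) a
    rw [deriv_expTail_of_zero hga] at this
    simp [hS, ha] at this
  have Sb : S b ≠ 0 := by
    intro hS
    have := deriv_of_eq_sub_mul (A := expTail) (a := b) (K := fun z => z ^ 2 * ((z - a) * S z))
      (by fun_prop) (fun z => by rw [eS]; ring) b
    rw [deriv_expTail_of_zero hgb] at this
    simp [hS, hb] at this
  have hS : ∀ z ∈ V, S z ≠ 0 := by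
    intro z hz hSz
    rcases hV z hz (by rw [eS, hSz]; ring) with rfl | rfl | rfl
    · exact S0 hSz
    · exact Sa hSz
    · exact Sb hSz
  have G1a : G1 a = a := by
    have := deriv_of_eq_sub_mul d1 e1 a
    rw [deriv_expTail_of_zero hga] at this
    simpa using this.symm
  have G2b : G2 b = b := by
    have := deriv_of_eq_sub_mul d2 e2 b
    rw [deriv_expTail_of_zero hgb] at this
    simpa using this.symm
  have G1b : G1 b = 0 := by
    have := e1 b
    rw [hgb] at this
    simpa [sub_eq_zero, hab.symm] using this
  have G2a : G2 a = 0 := by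
    have := e2 a
    rw [hga] at this
    simpa [sub_eq_zero, hab] using this
  have G10 : G1 0 = 0 := by
    have := e1 0
    rw [expTail_zero] at this
    simpa [ha] using this
  have G20 : G2 0 = 0 := by
    have := e2 0
    rw [expTail_zero] at this
    simpa [hb] using this
  have G10' : deriv G1 0 = 0 := by
    have := deriv_of_eq_sub_mul d1 e1 0
    rw [hg0', G10] at this
    simpa [ha] using this
  have G20' : deriv G2 0 = 0 := by
    have := deriv_of_eq_sub_mul d2 e2 0
    rw [hg0', G20] at this
    simpa [hb] using this
  -- The numerator left after subtracting the polar parts has the same forced zeros as `expTail`;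
  -- cancelling the common factor gives `h = Q / S`.
  obtain ⟨Q, dQ, eQ⟩ := exists_eq_sq_mul
    (A := fun z => z ^ 2 / 2 - a / 2 * G1 z - b / 2 * G2 z) (by fun_prop) ha hb hab
    (by simp [G10, G20])
    (by
      have := ((((hasDerivAt_id (0 : ℂ)).pow 2).div_const 2).sub
        ((d1 0).hasDerivAt.const_mul (a / 2))).sub ((d2 0).hasDerivAt.const_mul (b / 2))
      rw [G10', G20'] at this
      simpa [Pi.sub_def] using this.deriv)
    (by simp only [G1a, G2a]; ring) (by simp only [G1b, G2b]; ring)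
  refine ⟨fun z => Q z / S z, dQ.differentiableOn.div dS.differentiableOn hS, ?_⟩
  intro z hz hza hzb
  have hSz := hS z hz
  have hza' := sub_ne_zero.2 hza
  have hzb' := sub_ne_zero.2 hzb
  have eQz := eQ z
  have h1 : (Q z / S z) * expTail z = z ^ 2 / 2 - a / 2 * G1 z - b / 2 * G2 z := by
    rw [eQz, eS]
    field_simp
  have h2 : (z - a)⁻¹ * expTail z = G1 z := by rw [e1]; field_simp
  have h3 : (z - b)⁻¹ * expTail z = G2 z := by rw [e2]; field_simp
  linear_combination h1 + a / 2 * h2 + b / 2 * h3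

/-! ### Taylor coefficients at the origin. -/

theorem iteratedDeriv_expTail_zero (k : ℕ) :
    iteratedDeriv k expTail 0 = if k < 2 then 0 else 1 := by
  have h2 : deriv (fun z => Complex.exp z - 1) = Complex.exp := by
    funext z
    exact ((Complex.hasDerivAt_exp z).sub_const 1).deriv
  rcases k with _ | _ | k
  · simp [expTail_zero]
  · simp [iteratedDeriv_one, deriv_expTail]
  · rw [iteratedDeriv_succ', iteratedDeriv_succ', deriv_expTail, h2, iteratedDeriv_eq_iterate,
      Complex.iter_deriv_exp]
    simp

theorem iteratedDeriv_sq_div_two_zero (n : ℕ) :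
    iteratedDeriv (n + 2) (fun z : ℂ => z ^ 2 / 2) 0 = if n = 0 then 1 else 0 := by
  have h1 : deriv (fun z : ℂ => z ^ 2 / 2) = fun z => z := by
    funext z
    simp
  have h2 : deriv (fun z : ℂ => z) = fun _ => 1 := by
    funext z
    exact (hasDerivAt_id z).deriv
  rw [iteratedDeriv_succ', iteratedDeriv_succ', h1, h2, iteratedDeriv_const]

/-- The recurrence for the numbers `B_{2,n}`. -/
theorem hyperBernoulli_rec (n : ℕ) :
    ∑ i ∈ Finset.range (n + 1), ((n + 2).choose i : ℚ) * hyperBernoulli i =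
      if n = 0 then 1 else 0 := by
  have h0 : PowerSeries.constantCoeff expTailSeries ≠ 0 := by
    rw [← PowerSeries.coeff_zero_eq_constantCoeff_apply]
    simp [expTailSeries]
  have h1 : hyperBernoulliSeries * expTailSeries = 1 := PowerSeries.inv_mul_cancel _ h0
  have h2 := congrArg (PowerSeries.coeff n) h1
  rw [PowerSeries.coeff_mul, PowerSeries.coeff_one,
    Finset.Nat.sum_antidiagonal_eq_sum_range_succ_mk] at h2
  have h3 : ∑ i ∈ Finset.range (n + 1), ((n + 2).choose i : ℚ) * hyperBernoulli i =
      ((n + 2).factorial / 2 : ℚ) * ∑ i ∈ Finset.range (n + 1),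
        PowerSeries.coeff i hyperBernoulliSeries * PowerSeries.coeff (n - i) expTailSeries := by
    rw [Finset.mul_sum]
    refine Finset.sum_congr rfl fun i hi => ?_
    have hi' : i ≤ n := Nat.lt_succ_iff.1 (Finset.mem_range.1 hi)
    rw [hyperBernoulli, Nat.cast_choose ℚ (by omega : i ≤ n + 2), expTailSeries,
      PowerSeries.coeff_mk, Nat.sub_add_comm hi']
    have := Nat.factorial_ne_zero i
    have := Nat.factorial_ne_zero (n - i + 2)
    field_simp
  rw [h3, h2]
  rcases n with _ | n <;> simp

/-- A function analytic at `0` that inverts `2 (exp z - 1 - z) / z ^ 2` has the numbers `B_{2,n}`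
as derivatives at `0`. -/
theorem iteratedDeriv_eq_hyperBernoulli {f : ℂ → ℂ} (hf : AnalyticAt ℂ f 0)
    (h : (f * expTail) =ᶠ[nhds 0] fun z => z ^ 2 / 2) (n : ℕ) :
    iteratedDeriv n f 0 = hyperBernoulli n := by
  have hrec (n : ℕ) : ∑ i ∈ Finset.range (n + 1), ((n + 2).choose i : ℂ) * iteratedDeriv i f 0 =
      if n = 0 then 1 else 0 := by
    -- In Leibniz's rule of order `n + 2` the top two terms drop out, as `expTail` has a double zero
    -- at `0`.
    have h1 := iteratedDeriv_mul (n := n + 2) (x := 0) (hf.contDiffAt)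
      (differentiable_expTail.contDiff (n := ↑(n + 2))).contDiffAt
    rw [(h.iteratedDeriv_eq (n + 2)), iteratedDeriv_sq_div_two_zero, Finset.sum_range_succ,
      Finset.sum_range_succ] at h1
    rw [h1]
    have e1 : n + 2 - (n + 1) = 1 := by omega
    simp only [iteratedDeriv_expTail_zero, e1, Nat.sub_self]
    norm_num
    refine Finset.sum_congr rfl fun i hi => ?_
    have hi' : i ≤ n := Nat.lt_succ_iff.1 (Finset.mem_range.1 hi)
    rw [if_neg (by omega)]
  induction n using Nat.strong_induction_on with
  | _ n ih =>
    have h1 := hrec n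
    have h2 := congrArg (fun q : ℚ => (q : ℂ)) (hyperBernoulli_rec n)
    rw [Finset.sum_range_succ] at h1
    simp only [Finset.sum_range_succ] at h2
    push_cast [apply_ite (Rat.cast : ℚ → ℂ)] at h2
    rw [Finset.sum_congr rfl fun i hi => by rw [ih i (Finset.mem_range.1 hi)], ← h2] at h1
    have h3 : ((n + 2).choose n : ℂ) ≠ 0 := by
      exact_mod_cast (Nat.choose_pos (by omega)).ne'
    exact mul_left_cancel₀ h3 (add_left_cancel h1)

theorem iteratedDeriv_inv_sub_zero {a : ℂ} (ha : a ≠ 0) (n : ℕ) :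
    iteratedDeriv n (fun z => (z - a)⁻¹) 0 = -(n.factorial : ℂ) / a ^ (n + 1) := by
  have := iter_deriv_inv_linear_sub n 1 a
  simp only [one_mul] at this
  rw [iteratedDeriv_eq_iterate, this]
  simp only [one_pow, mul_one, zero_sub]
  rw [show (-1 - (n : ℤ)) = -((n + 1 : ℕ) : ℤ) by push_cast; ring, zpow_neg, zpow_natCast,
    neg_pow a, pow_succ (-1 : ℂ)]
  have : ((-1 : ℂ) ^ n) ≠ 0 := by simp
  field_simp

/-! ### Estimates on the rectangle and the asymptotic formula. -/

open ComplexConjugate in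
theorem expTail_conj (z : ℂ) : expTail (conj z) = conj (expTail z) := by
  simp [expTail, Complex.exp_conj]

open ComplexConjugate in
/-- The zeros of `exp z - 1 - z` in the strip `|Im z| < 12`. -/
theorem expTail_zeros_in_strip {a z : ℂ} (ha : a ∈ contractionRegion) (hf : shiftedLog a = a)
    (hz : |z.im| < 12) (h : expTail z = 0) : z = 0 ∨ z = a ∨ z = conj a := by
  have hpi := Real.pi_gt_three
  have key (w : ℂ) (hw : 0 < w.im) (hw' : w.im < 12) (h : expTail w = 0) : w = a := by
    obtain ⟨h5, h6⟩ := shiftedLog_of_zero hw h (by linarith)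
    exact shiftedLog_unique h5 ha h6 hf
  rw [abs_lt] at hz
  rcases lt_trichotomy z.im 0 with h1 | h1 | h1
  · right; right
    have := key (conj z) (by simpa using h1) (by simp; linarith) (by rw [expTail_conj, h, map_zero])
    rw [← this, Complex.conj_conj]
  · left
    have h2 := (exp_eq_iff_re_im.1 h).1
    rw [h1, Real.cos_zero, mul_one] at h2
    have h3 : z.re = 0 := by
      by_contra h4
      linarith [Real.add_one_lt_exp h4]
    exact Complex.ext h3 h1
  · right; left
    exact key z h1 hz.2 h

/-- At height `±7π/2` the sine is `∓1`, so the two terms of the imaginary part add up without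
cancellation. On the right side the exponential dominates, on the left side `1 + z` does. -/
theorem nine_le_norm_expTail {z : ℂ}
    (h : |z.re| = 11 ∧ |z.im| ≤ 7 * Real.pi / 2 ∨ |z.re| ≤ 11 ∧ |z.im| = 7 * Real.pi / 2) :
    9 ≤ ‖expTail z‖ := by
  have hpi := Real.pi_gt_d2
  have hpi' := Real.pi_lt_d4
  rcases h with ⟨h1, h2⟩ | ⟨h1, h2⟩
  · have h5 : ‖Complex.exp z‖ = Real.exp z.re := Complex.norm_exp z
    rcases abs_eq (by norm_num : (0 : ℝ) ≤ 11) |>.1 h1 with h3 | h3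
    · have h4 : ‖1 + z‖ ≤ 23 := by
        have := Complex.norm_le_abs_re_add_abs_im z
        have := norm_add_le 1 z
        rw [norm_one] at this
        linarith
      have h6 := Real.quadratic_le_exp_of_nonneg (x := 11) (by norm_num)
      have h7 := norm_sub_norm_le (Complex.exp z) (1 + z)
      rw [h5, h3, ← sub_sub] at h7
      change _ ≤ ‖expTail z‖ at h7
      linarith
    · have h4 : 10 ≤ ‖1 + z‖ := by
        have := Complex.abs_re_le_norm (1 + z)
        simp only [Complex.add_re, Complex.one_re, h3] at this
        norm_num at this
        exact this
      have h6 : Real.exp (-11) ≤ 1 := Real.exp_le_one_iff.2 (by norm_num)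
      have h7 := norm_sub_norm_le (1 + z) (Complex.exp z)
      rw [norm_sub_rev, h5, h3, ← sub_sub] at h7
      change _ ≤ ‖expTail z‖ at h7
      linarith
  · have h3 : |(expTail z).im| = Real.exp z.re + 7 * Real.pi / 2 := by
      have e : (expTail z).im = Real.exp z.re * Real.sin z.im - z.im := by
        simp [expTail, Complex.exp_im]
      have hsin : Real.sin (7 * Real.pi / 2) = -1 := by
        rw [show 7 * Real.pi / 2 = -(Real.pi / 2) + 2 * Real.pi + 2 * Real.pi by ring,
          Real.sin_add_two_pi, Real.sin_add_two_pi, Real.sin_neg, Real.sin_pi_div_two]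
      have hE := Real.exp_pos z.re
      rw [e]
      rcases abs_eq (by linarith : 0 ≤ 7 * Real.pi / 2) |>.1 h2 with h4 | h4
      · rw [h4, hsin, abs_of_neg (by linarith)]
        ring
      · rw [h4, Real.sin_neg, hsin, abs_of_pos (by linarith)]
        ring
    have := Complex.abs_im_le_norm (expTail z)
    linarith [Real.exp_pos z.re]

theorem norm_half_mul_inv_sub_le {a z : ℂ} (ha : ‖a‖ < 7.7485) (hre : |a.re| ≤ 2.1)
    (him : |a.im| ≤ 7.462)
    (h : |z.re| = 11 ∧ |z.im| ≤ 7 * Real.pi / 2 ∨ |z.re| ≤ 11 ∧ |z.im| = 7 * Real.pi / 2) :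
    z ≠ a ∧ ‖a / 2 * (z - a)⁻¹‖ ≤ 1.2 := by
  have hpi := Real.pi_gt_d2
  have h1 : 3.5 ≤ ‖z - a‖ := by
    rcases h with ⟨h1, -⟩ | ⟨-, h1⟩
    · have h2 := Complex.abs_re_le_norm (z - a)
      have h3 := abs_sub_abs_le_abs_sub z.re a.re
      rw [Complex.sub_re] at h2
      linarith
    · have h2 := Complex.abs_im_le_norm (z - a)
      have h3 := abs_sub_abs_le_abs_sub z.im a.im
      rw [Complex.sub_im] at h2
      linarith
  refine ⟨?_, ?_⟩
  · rintro rfl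
    norm_num at h1
  · rw [norm_mul, norm_div, norm_inv, ← div_eq_mul_inv, div_le_iff₀ (by linarith)]
    norm_num at ha h1 ⊢
    linarith

/-- The quotient is at most `121 / 9 < 13.5`, and the polar parts add at most `2.4`. -/
theorem norm_le_sixteen_of_mem_frontier {a b z : ℂ} {h : ℂ → ℂ}
    (haa : ‖a / 2 * (z - a)⁻¹‖ ≤ 1.2) (hbb : ‖b / 2 * (z - b)⁻¹‖ ≤ 1.2)
    (hz : |z.re| = 11 ∧ |z.im| ≤ 7 * Real.pi / 2 ∨ |z.re| ≤ 11 ∧ |z.im| = 7 * Real.pi / 2)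
    (hh : (h z + a / 2 * (z - a)⁻¹ + b / 2 * (z - b)⁻¹) * expTail z = z ^ 2 / 2) :
    ‖h z‖ ≤ 16 := by
  have hpi' := Real.pi_lt_d4
  have h9 := nine_le_norm_expTail hz
  have h1 : |z.re| ≤ 11 := by rcases hz with h | h <;> linarith [h.1]
  have h2 : |z.im| ≤ 11 := by rcases hz with h | h <;> linarith [h.2]
  have h3 : ‖z‖ ^ 2 ≤ 242 := by
    rw [Complex.sq_norm, Complex.normSq_apply]
    nlinarith [abs_mul_abs_self z.re, abs_mul_abs_self z.im, abs_nonneg z.re, abs_nonneg z.im]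
  have h4 : ‖h z + a / 2 * (z - a)⁻¹ + b / 2 * (z - b)⁻¹‖ ≤ 13.5 := by
    have := congrArg norm hh
    rw [norm_mul, norm_div, norm_pow] at this
    norm_num at this
    by_contra hc
    have hc := not_le.1 hc
    nlinarith
  have h5 : h z = (h z + a / 2 * (z - a)⁻¹ + b / 2 * (z - b)⁻¹) - b / 2 * (z - b)⁻¹
      - a / 2 * (z - a)⁻¹ := by ring
  rw [h5]
  refine (norm_sub_le _ _).trans ?_
  have := norm_sub_le (h z + a / 2 * (z - a)⁻¹ + b / 2 * (z - b)⁻¹) (b / 2 * (z - b)⁻¹)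
  linarith

open ComplexConjugate in
/-- The main asymptotic estimate for `B_{2,n} / n!`. -/
theorem abs_hyperBernoulli_add_le {a : ℂ} (ha : a ∈ contractionRegion) (hf : shiftedLog a = a)
    (happ : ‖a - ⟨2.088843, 7.461489⟩‖ ≤ 0.0001) (n : ℕ) :
    |(hyperBernoulli n : ℝ) / n.factorial + ((a ^ n)⁻¹).re| ≤ 16 / 10.9 ^ n := by
  have hpi := Real.pi_gt_d2
  have hpi' := Real.pi_lt_d4
  obtain ⟨hn1, hn2⟩ := norm_bounds_of_approx happ
  have him : 6 ≤ a.im := ha.2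
  have hre' := (Complex.abs_re_le_norm _).trans happ
  have him' := (Complex.abs_im_le_norm _).trans happ
  rw [abs_le] at hre' him'
  simp only [Complex.sub_re, Complex.sub_im] at hre' him'
  have hare : |a.re| ≤ 2.1 := by rw [abs_le]; constructor <;> linarith
  have haim : |a.im| ≤ 7.462 := by rw [abs_le]; constructor <;> linarith
  have ha0 : a ≠ 0 := by
    rintro rfl
    norm_num at him
  set b : ℂ := conj a with hb
  have hb0 : b ≠ 0 := by simpa [hb] using ha0
  have hab : a ≠ b := by
    intro h
    have := congrArg Complex.im h
    simp [hb] at this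
    linarith
  have hga : expTail a = 0 := shiftedLog_fixed ha hf
  have hgb : expTail b = 0 := by rw [hb, expTail_conj, hga, map_zero]
  -- The bound 12 lies between `7π/2`, the half-height of the rectangle, and `4π`.
  set V : Set ℂ := {z | |z.im| < 12} with hV
  obtain ⟨h, dh, eh⟩ := exists_regular_part ha0 hb0 hab hga hgb
    (V := V) (fun z hz h0 => expTail_zeros_in_strip ha hf hz h0)
  set U : Set ℂ := Set.Ioo (-11) 11 ×ℂ Set.Ioo (-(7 * Real.pi / 2)) (7 * Real.pi / 2) with hU
  have hcl : closure U = Set.Icc (-11) 11 ×ℂ Set.Icc (-(7 * Real.pi / 2)) (7 * Real.pi / 2) := by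
    rw [hU, Complex.closure_reProdIm, closure_Ioo (by norm_num), closure_Ioo (by linarith)]
  have hUV : closure U ⊆ V := by
    rw [hcl]
    rintro z ⟨-, h1, h2⟩
    change |z.im| < 12
    rw [abs_lt]
    constructor <;> linarith
  have hfr : ∀ z ∈ frontier U, |z.re| = 11 ∧ |z.im| ≤ 7 * Real.pi / 2 ∨
      |z.re| ≤ 11 ∧ |z.im| = 7 * Real.pi / 2 := by
    intro z hz
    rw [hU, Complex.frontier_reProdIm, closure_Ioo (by norm_num), closure_Ioo (by linarith),
      frontier_Ioo (by linarith : -(7 * Real.pi / 2) < 7 * Real.pi / 2), frontier_Ioo (by norm_num)] at hz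
    rcases hz with ⟨h1, h2⟩ | ⟨h1, h2⟩
    · right
      refine ⟨abs_le.2 h1, ?_⟩
      rcases h2 with h2 | h2
      · rw [h2, abs_neg, abs_of_nonneg (by linarith)]
      · rw [h2, abs_of_nonneg (by linarith)]
    · left
      refine ⟨?_, abs_le.2 h2⟩
      rcases h1 with h1 | h1 <;> rw [h1] <;> norm_num
  have hbound : ∀ z ∈ closure U, ‖h z‖ ≤ 16 := by
    intro z hz
    refine Complex.norm_le_of_forall_mem_frontier_norm_le (U := U)
      ((Metric.isBounded_Ioo _ _).reProdIm (Metric.isBounded_Ioo _ _))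
      ((dh.mono hUV).diffContOnCl) (fun w hw => ?_) hz
    obtain ⟨hwa, hwa'⟩ := norm_half_mul_inv_sub_le hn2 hare haim (hfr w hw)
    obtain ⟨hwb, hwb'⟩ := norm_half_mul_inv_sub_le (a := b) (by simpa [hb] using hn2)
      (by simpa [hb] using hare) (by simpa [hb] using haim) (hfr w hw)
    exact norm_le_sixteen_of_mem_frontier hwa' hwb' (hfr w hw)
      (eh w (hUV (frontier_subset_closure hw)) hwa hwb)
  have hball : Metric.closedBall (0 : ℂ) 10.9 ⊆ closure U := by
    intro z hz
    rw [mem_closedBall_zero_iff] at hz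
    have h1 := abs_le.1 ((Complex.abs_re_le_norm z).trans hz)
    have h2 := abs_le.1 ((Complex.abs_im_le_norm z).trans hz)
    rw [hcl]
    refine ⟨⟨?_, ?_⟩, ⟨?_, ?_⟩⟩ <;> linarith
  have hCauchy : ‖iteratedDeriv n h 0‖ ≤ n.factorial * 16 / 10.9 ^ n := by
    refine Complex.norm_iteratedDeriv_le_of_forall_mem_sphere_norm_le n (by norm_num)
      ?_ fun z hz => hbound z (hball (Metric.sphere_subset_closedBall hz))
    apply DifferentiableOn.diffContOnCl
    rw [closure_ball _ (by norm_num)]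
    exact dh.mono (hball.trans hUV)
  have hVo : IsOpen V := isOpen_lt (continuous_abs.comp Complex.continuous_im) continuous_const
  have h0V : (0 : ℂ) ∈ V := by simp [hV]
  have anh : AnalyticAt ℂ h 0 := dh.analyticAt (hVo.mem_nhds h0V)
  have ana : AnalyticAt ℂ (fun z => a / 2 * (z - a)⁻¹) 0 :=
    analyticAt_const.mul ((analyticAt_id.sub analyticAt_const).inv (by simpa using ha0))
  have anb : AnalyticAt ℂ (fun z => b / 2 * (z - b)⁻¹) 0 :=
    analyticAt_const.mul ((analyticAt_id.sub analyticAt_const).inv (sub_ne_zero.2 hb0.symm))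
  have hB := iteratedDeriv_eq_hyperBernoulli ((anh.add ana).add anb) (by
    filter_upwards [hVo.mem_nhds h0V, isOpen_ne.mem_nhds ha0.symm, isOpen_ne.mem_nhds hb0.symm]
      with z hz hza hzb
    exact eh z hz hza hzb) n
  rw [iteratedDeriv_add (anh.add ana).contDiffAt anb.contDiffAt,
    iteratedDeriv_add anh.contDiffAt ana.contDiffAt, iteratedDeriv_const_mul_field,
    iteratedDeriv_const_mul_field, iteratedDeriv_inv_sub_zero ha0,
    iteratedDeriv_inv_sub_zero hb0] at hB
  have hn : (n.factorial : ℂ) ≠ 0 := by exact_mod_cast n.factorial_ne_zero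
  -- Each polar part contributes `-n! / 2` times the inverse `n`-th power of its pole.
  have hre : (((a ^ n)⁻¹).re : ℂ) = ((a ^ n)⁻¹ + (b ^ n)⁻¹) / 2 := by
    rw [Complex.re_eq_add_conj, map_inv₀, map_pow]
  have hfin : (((hyperBernoulli n : ℝ) / n.factorial + ((a ^ n)⁻¹).re : ℝ) : ℂ) =
      iteratedDeriv n h 0 / n.factorial := by
    push_cast
    rw [hre, ← hB]
    field_simp
    ring
  have : |(hyperBernoulli n : ℝ) / n.factorial + ((a ^ n)⁻¹).re| =
      ‖iteratedDeriv n h 0‖ / n.factorial := by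
    rw [← Real.norm_eq_abs, ← Complex.norm_real, hfin, norm_div, Complex.norm_natCast]
  rw [this, div_le_iff₀ (by positivity)]
  refine hCauchy.trans (le_of_eq ?_)
  ring

/-! ### Small indices and numerical comparisons. -/

theorem hyperBernoulli_values :
    hyperBernoulli 3 = 1 / 90 ∧ hyperBernoulli 4 = -1 / 270 ∧ hyperBernoulli 5 = -5 / 1134 ∧
      hyperBernoulli 6 = -1 / 5670 ∧ hyperBernoulli 7 = 7 / 2430 ∧
      hyperBernoulli 8 = 13 / 7290 := by
  have e0 := hyperBernoulli_rec 0
  have e1 := hyperBernoulli_rec 1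
  have e2 := hyperBernoulli_rec 2
  have e3 := hyperBernoulli_rec 3
  have e4 := hyperBernoulli_rec 4
  have e5 := hyperBernoulli_rec 5
  have e6 := hyperBernoulli_rec 6
  have e7 := hyperBernoulli_rec 7
  have e8 := hyperBernoulli_rec 8
  simp only [Finset.sum_range_succ, Finset.sum_range_zero, Nat.choose] at e0 e1 e2 e3 e4 e5 e6 e7 e8
  norm_num at e0 e1 e2 e3 e4 e5 e6 e7 e8
  refine ⟨?_, ?_, ?_, ?_, ?_, ?_⟩ <;> linarith

theorem abs_hyperBernoulli_lt_of_le_eight {r : ℝ} (hr0 : 0 < r) (hr : r < 7.7485) {n : ℕ}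
    (hn : 2 < n) (hn8 : n ≤ 8) : |(hyperBernoulli n : ℝ)| < 2 * n.factorial / r ^ n := by
  rw [lt_div_iff₀ (pow_pos hr0 n)]
  have h1 : |(hyperBernoulli n : ℝ)| * r ^ n ≤ |(hyperBernoulli n : ℝ)| * 7.7485 ^ n := by
    gcongr
  refine h1.trans_lt ?_
  obtain ⟨h3, h4, h5, h6, h7, h8⟩ := hyperBernoulli_values
  interval_cases n <;> simp only [h3, h4, h5, h6, h7, h8] <;>
    norm_num [Nat.factorial, abs_of_neg, abs_of_pos]

theorem abs_hyperBernoulli_lt_seven_of_le_six {n : ℕ}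
    (hn : 2 < n) (hn6 : n ≤ 6) : |(hyperBernoulli n : ℝ)| < n.factorial / 7 ^ n := by
  obtain ⟨h3, h4, h5, h6, -, -⟩ := hyperBernoulli_values
  interval_cases n <;> simp only [h3, h4, h5, h6] <;>
    norm_num [Nat.factorial, abs_of_neg, abs_of_pos]

/-- `(7.7482 / 7) ^ 7 > 2`, while the sixth power falls short. -/
theorem two_mul_seven_pow_lt {r : ℝ} (hr : 7.7482 < r) {n : ℕ} (hn : 7 ≤ n) :
    2 * 7 ^ n < r ^ n := by
  obtain ⟨k, rfl⟩ := Nat.exists_eq_add_of_le hn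
  rw [pow_add, pow_add]
  have h1 : (7 : ℝ) ^ k ≤ r ^ k := pow_le_pow_left₀ (by norm_num) (by linarith) k
  have h2 : (7.7482 : ℝ) ^ 7 ≤ r ^ 7 := pow_le_pow_left₀ (by norm_num) hr.le 7
  have h3 : (0 : ℝ) < 7 ^ k := by positivity
  norm_num at h2 ⊢
  nlinarith

/-- `(10.9 / 7.7485) ^ 9 > 16`; the eighth power is too small, so exact values are needed up to `n =
8`. -/
theorem sixteen_div_lt {r : ℝ} (hr0 : 0 < r) (hr : r < 7.7485) {n : ℕ} (hn : 9 ≤ n) :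
    16 / 10.9 ^ n < 1 / r ^ n := by
  rw [div_lt_div_iff₀ (by positivity) (by positivity), one_mul]
  obtain ⟨k, rfl⟩ := Nat.exists_eq_add_of_le hn
  rw [pow_add, pow_add]
  have h1 : r ^ k ≤ 10.9 ^ k := pow_le_pow_left₀ hr0.le (by norm_num at hr ⊢; linarith) k
  have h2 : r ^ 9 ≤ 7.7485 ^ 9 := pow_le_pow_left₀ hr0.le hr.le 9
  have h3 : 16 * r ^ 9 < 10.9 ^ 9 := by
    norm_num at h2 ⊢
    linarith
  have h4 : 0 < r ^ k := by positivity
  calc 16 * (r ^ 9 * r ^ k) = 16 * r ^ 9 * r ^ k := by ring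
    _ < 10.9 ^ 9 * r ^ k := mul_lt_mul_of_pos_right h3 h4
    _ ≤ 10.9 ^ 9 * 10.9 ^ k := by gcongr

theorem abs_re_inv_pow_le (a : ℂ) (n : ℕ) : |((a ^ n)⁻¹).re| ≤ 1 / ‖a‖ ^ n := by
  have := Complex.abs_re_le_norm (a ^ n)⁻¹
  rw [norm_inv, norm_pow] at this
  rwa [one_div]

/-! ### Sharpness and radius of convergence. -/

/-- Infinitely many powers of `a⁻¹` have a large real part. -/
theorem frequently_half_le_abs_re {a : ℂ} (ha : a ≠ 0) :
    ∃ᶠ n : ℕ in Filter.atTop, 1 / 2 ≤ |((a ^ n)⁻¹).re| * ‖a‖ ^ n := by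
  rw [Filter.frequently_atTop]
  intro N
  by_cases h : 1 / 2 ≤ |((a ^ N)⁻¹).re| * ‖a‖ ^ N
  · exact ⟨N, le_rfl, h⟩
  -- Angle doubling: `|cos θ| < 1 / 2` forces `|cos 2θ| > 1 / 2`.
  refine ⟨2 * N, by omega, ?_⟩
  have hr : 0 < ‖a‖ := norm_pos_iff.2 ha
  set w := (a ^ N)⁻¹ with hw
  set s := ‖a‖ ^ N with hs
  have hspos : 0 < s := by positivity
  have hsw : (w.re ^ 2 + w.im ^ 2) * s ^ 2 = 1 := by
    have h1 : ‖w‖ * s = 1 := by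
      rw [hw, norm_inv, norm_pow, ← hs]
      field_simp
    have h2 : ‖w‖ ^ 2 = w.re ^ 2 + w.im ^ 2 := by
      rw [Complex.sq_norm, Complex.normSq_apply]
      ring
    rw [← h2, ← mul_pow, h1, one_pow]
  have h1 : (a ^ (2 * N))⁻¹ = w ^ 2 := by
    rw [hw, mul_comm, pow_mul, inv_pow]
  have h2 : ‖a‖ ^ (2 * N) = s ^ 2 := by
    rw [hs, mul_comm, pow_mul]
  have h3 : (w ^ 2).re = w.re ^ 2 - w.im ^ 2 := by
    rw [sq, Complex.mul_re]
    ring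
  rw [h1, h2, h3]
  have h4 : (|w.re| * s) ^ 2 < (1 / 2) ^ 2 :=
    pow_lt_pow_left₀ (not_le.1 h) (by positivity) (by norm_num)
  rw [mul_pow, sq_abs] at h4
  have h5 := neg_abs_le (w.re ^ 2 - w.im ^ 2)
  have h6 : -(w.re ^ 2 - w.im ^ 2) * s ^ 2 ≤ |w.re ^ 2 - w.im ^ 2| * s ^ 2 := by
    gcongr
    linarith
  nlinarith

/-- After scaling by `‖a‖ ^ n` the main term is infinitely often at least `1 / 2`, while the error
and `C * (‖a‖ / R) ^ n` both fall below `1 / 4`. -/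
theorem frequently_lt_of_asymptotic {u : ℕ → ℝ} {a : ℂ} (ha : a ≠ 0) (hr : ‖a‖ < 10.9)
    (hu : ∀ n, |u n + ((a ^ n)⁻¹).re| ≤ 16 / 10.9 ^ n) {R C : ℝ} (hR : ‖a‖ < R) :
    ∃ᶠ n : ℕ in Filter.atTop, C / R ^ n < |u n| := by
  have hr0 : 0 < ‖a‖ := norm_pos_iff.2 ha
  have hR0 : 0 < R := hr0.trans hR
  have t1 : Filter.Tendsto (fun n : ℕ => 16 * (‖a‖ / 10.9) ^ n) Filter.atTop (nhds (16 * 0)) :=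
    (tendsto_pow_atTop_nhds_zero_of_lt_one (by positivity)
      ((div_lt_one (by norm_num)).2 hr)).const_mul 16
  have t2 : Filter.Tendsto (fun n : ℕ => C * (‖a‖ / R) ^ n) Filter.atTop (nhds (C * 0)) :=
    (tendsto_pow_atTop_nhds_zero_of_lt_one (by positivity)
      ((div_lt_one hR0).2 hR)).const_mul C
  have h1 := t1.eventually_lt_const (by norm_num : (16 * 0 : ℝ) < 1 / 4)
  have h2 := t2.eventually_lt_const (by norm_num : (C * 0 : ℝ) < 1 / 4)
  refine ((frequently_half_le_abs_re ha).and_eventually (h1.and h2)).mono ?_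
  rintro n ⟨h3, h4, h5⟩
  have hp : 0 < ‖a‖ ^ n := by positivity
  have h6 : |((a ^ n)⁻¹).re| ≤ |u n| + 16 / 10.9 ^ n := by
    have := abs_sub_abs_le_abs_sub (((a ^ n)⁻¹).re) (-u n)
    rw [abs_neg, sub_neg_eq_add, add_comm (((a ^ n)⁻¹).re)] at this
    linarith [hu n]
  have h7 : C / R ^ n * ‖a‖ ^ n < |u n| * ‖a‖ ^ n := by
    have e1 : C / R ^ n * ‖a‖ ^ n = C * (‖a‖ / R) ^ n := by rw [div_pow]; ring
    have e2 : 16 / 10.9 ^ n * ‖a‖ ^ n = 16 * (‖a‖ / 10.9) ^ n := by rw [div_pow]; ring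
    rw [e1]
    rw [← e2] at h4
    have := mul_le_mul_of_nonneg_right h6 hp.le
    rw [add_mul] at this
    linarith
  exact lt_of_mul_lt_mul_right h7 hp.le

theorem radius_ofScalars_eq {u : ℕ → ℝ} {c : ℕ → ℂ} {a : ℂ} (ha : a ≠ 0) (hr : ‖a‖ < 10.9)
    (hc : ∀ n, ‖c n‖ = |u n|)
    (hu : ∀ n, |u n + ((a ^ n)⁻¹).re| ≤ 16 / 10.9 ^ n) :
    (FormalMultilinearSeries.ofScalars ℂ c).radius = ENNReal.ofReal ‖a‖ := by
  have hr0 : 0 < ‖a‖ := norm_pos_iff.2 ha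
  apply le_antisymm
  · by_contra hlt
    obtain ⟨R, hR1, hR2⟩ := ENNReal.lt_iff_exists_nnreal_btwn.1 (not_le.1 hlt)
    obtain ⟨C, -, hC⟩ := FormalMultilinearSeries.norm_mul_pow_le_of_lt_radius _ hR2
    have hR : ‖a‖ < R := by
      rw [← ENNReal.ofReal_coe_nnreal] at hR1
      exact (ENNReal.ofReal_lt_ofReal_iff_of_nonneg (norm_nonneg a)).1 hR1
    have hRpos : (0 : ℝ) < R := hr0.trans hR
    obtain ⟨n, hn⟩ := (frequently_lt_of_asymptotic (C := C) ha hr hu hR).exists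
    have := hC n
    rw [FormalMultilinearSeries.ofScalars_norm, hc] at this
    rw [div_lt_iff₀ (by positivity)] at hn
    linarith
  · refine FormalMultilinearSeries.le_radius_of_bound _ 17 fun n => ?_
    rw [FormalMultilinearSeries.ofScalars_norm, hc, Real.coe_toNNReal _ (norm_nonneg a)]
    have hp : 0 < ‖a‖ ^ n := by positivity
    have h1 := abs_sub (u n + ((a ^ n)⁻¹).re) (((a ^ n)⁻¹).re)
    rw [add_sub_cancel_right] at h1
    have h2 : |u n| ≤ 16 / 10.9 ^ n + 1 / ‖a‖ ^ n :=
      h1.trans (add_le_add (hu n) (abs_re_inv_pow_le a n))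
    have h3 : 16 / 10.9 ^ n ≤ 16 / ‖a‖ ^ n := by gcongr
    calc |u n| * ‖a‖ ^ n ≤ (16 / ‖a‖ ^ n + 1 / ‖a‖ ^ n) * ‖a‖ ^ n := by gcongr; linarith
      _ = 17 := by field_simp; norm_num

/-! ### Assembly of the theorem. -/

theorem mainTheorem8 :
    (∃ z₁ : ℂ, IsFirstUpperZero z₁ ∧
      -- the numerical value of `r₁ = ‖z₁‖`, to three decimals
      |‖z₁‖ - 7.748| < 0.0005 ∧
      -- the bound with base `r₁`
      (∀ n : ℕ, 2 < n →
        |(hyperBernoulli n : ℝ)| < 2 * (n.factorial : ℝ) / ‖z₁‖ ^ n) ∧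
      -- the radius of convergence of the generating series is `r₁`
      (FormalMultilinearSeries.ofScalars ℂ
        (fun n : ℕ => (hyperBernoulli n : ℂ) / (n.factorial : ℂ))).radius
          = ENNReal.ofReal ‖z₁‖ ∧
      -- sharpness: `r₁` cannot be replaced by a larger number
      (∀ R C : ℝ, ‖z₁‖ < R →
        ∃ᶠ n : ℕ in Filter.atTop,
          C * (n.factorial : ℝ) / R ^ n < |(hyperBernoulli n : ℝ)|)) ∧
    -- Howard's conjecture
    (∀ n : ℕ, 2 < n →
      |(hyperBernoulli n : ℝ)| < (n.factorial : ℝ) / 7 ^ n) ∧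
    -- the sequence is unbounded
    (∀ M : ℝ, ∃ n : ℕ, M < |(hyperBernoulli n : ℝ)|) := by
  obtain ⟨a, ha, hf, happ⟩ := exists_first_zero
  obtain ⟨hn1, hn2⟩ := norm_bounds_of_approx happ
  have hr0 : 0 < ‖a‖ := by linarith
  have ha0 : a ≠ 0 := norm_pos_iff.1 hr0
  have hr : ‖a‖ < 10.9 := by linarith
  have hu := abs_hyperBernoulli_add_le ha hf happ
  have habs (n : ℕ) : |(hyperBernoulli n : ℝ) / n.factorial| =
      |(hyperBernoulli n : ℝ)| / n.factorial := by rw [abs_div, Nat.abs_cast]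
  have hfac (n : ℕ) : (0 : ℝ) < n.factorial := by positivity
  have hfirst : ∀ n : ℕ, 2 < n →
      |(hyperBernoulli n : ℝ)| < 2 * (n.factorial : ℝ) / ‖a‖ ^ n := by
    intro n hn
    rcases le_or_gt n 8 with h8 | h8
    · exact abs_hyperBernoulli_lt_of_le_eight hr0 hn2 hn h8
    have h1 := abs_sub ((hyperBernoulli n : ℝ) / n.factorial + ((a ^ n)⁻¹).re) (((a ^ n)⁻¹).re)
    rw [add_sub_cancel_right, habs] at h1
    have h2 : |(hyperBernoulli n : ℝ)| / n.factorial < 1 / ‖a‖ ^ n + 1 / ‖a‖ ^ n :=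
      h1.trans_lt (add_lt_add_of_lt_of_le ((hu n).trans_lt (sixteen_div_lt hr0 hn2 h8))
        (abs_re_inv_pow_le a n))
    rw [div_lt_iff₀ (hfac n)] at h2
    exact h2.trans_eq (by ring)
  have hsharp : ∀ R C : ℝ, ‖a‖ < R → ∃ᶠ n : ℕ in Filter.atTop,
      C * (n.factorial : ℝ) / R ^ n < |(hyperBernoulli n : ℝ)| := by
    intro R C hR
    refine (frequently_lt_of_asymptotic (C := C) ha0 hr hu hR).mono fun n hn => ?_
    rw [habs, lt_div_iff₀ (hfac n)] at hn
    exact (hn.trans_eq' (by ring))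
  refine ⟨⟨a, isFirstUpperZero_of_fixed ha hf happ, ?_, hfirst, ?_, hsharp⟩, ?_, ?_⟩
  · rw [abs_lt]
    constructor <;> linarith
  · refine radius_ofScalars_eq ha0 hr (fun n => ?_) hu
    rw [habs, norm_div, Complex.norm_natCast, ← Complex.ofReal_ratCast, Complex.norm_real,
      Real.norm_eq_abs]
  · intro n hn
    rcases le_or_gt n 6 with h6 | h6
    · exact abs_hyperBernoulli_lt_seven_of_le_six hn h6
    refine (hfirst n hn).trans ?_
    rw [div_lt_div_iff₀ (by positivity) (by positivity)]
    have := mul_lt_mul_of_pos_left (two_mul_seven_pow_lt hn1 h6) (hfac n)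
    linarith
  · intro M
    -- Sharpness with `R = 8 > r₁` and `C = 1` gives `|B_{2,n}| > n! / 8 ^ n` infinitely often, and
    -- `n! / 8 ^ n` tends to infinity.
    have t := FloorSemiring.tendsto_pow_div_factorial_atTop (8 : ℝ)
    have h1 := t.eventually_lt_const (by positivity : (0 : ℝ) < 1 / (|M| + 1))
    obtain ⟨n, h2, h3⟩ := ((hsharp 8 1 (by linarith)).and_eventually h1).exists
    refine ⟨n, lt_trans ?_ h2⟩
    rw [div_lt_div_iff₀ (hfac n) (by positivity)] at h3
    rw [lt_div_iff₀ (by positivity)]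
    have h4 : M * 8 ^ n ≤ |M| * 8 ^ n := by gcongr; exact le_abs_self M
    have h5 : (0 : ℝ) < 8 ^ n := by positivity
    linarith
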